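/- Let $M$ be a smooth $4$-dimensional manifold (without boundary) and let $f\colon M\to\mathbb S^5$ be a smooth immersion into the unit sphere $\mathbb S^5\subset\mathbb R^6$, i.e. an immersed hypersurface. For a local smooth unit normal field $\nu$ of $f$ in $\mathbb S^5$, let $A(v,w)=-\langle d\nu(v),df(w)\rangle$ be the second fundamental form and $S$ the shape operator, $df(Sv)=-d\nu(v)$; the principal curvatures $\lambda_1,\dots,\lambda_4$ are the eigenvalues of $S$, counted with multiplicity, the mean curvature is $H=\frac14\operatorname{tr}S=\frac14\sum_i\lambda_i$, and the Gauss (Gauss–Kronecker) curvature is $\mathcal K=\det S=\lambda_1\lambda_2\lambda_3\lambda_4$. Assume that - the hypersurface is minimal, i.e. $H\equiv0$; - it is isoparametric, i.e. its principal curvatures are constant: there are fixed real numbers $c_1,\dots,c_4$ such that near every point of $M$ there is a smooth unit normal field with respect to which the principal curvatures, counted with multiplicity, are $c_1,\dots,c_4$; - $\mathcal K\equiv 0$. Then the hypersurface is totally geodesic, i.e. $A\equiv0$. -/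

import Mathlib

open scoped Manifold ContDiff

noncomputable section

namespace SphereHypersurface

/-- The ambient Euclidean space `ℝⁿ⁺²` of the unit sphere `Sⁿ⁺¹`. -/
abbrev Ambient (n : ℕ) : Type := EuclideanSpace ℝ (Fin (n + 1 + 1))

/-- The unit sphere `Sⁿ⁺¹ ⊆ ℝⁿ⁺²`. -/
abbrev UnitSphere (n : ℕ) : Type := Metric.sphere (0 : Ambient n) 1

variable {n : ℕ} {M : Type*} [TopologicalSpace M] [ChartedSpace (EuclideanSpace ℝ (Fin n)) M]

instance finite_tangentSpace (p : M) : Module.Finite ℝ (TangentSpace (𝓡 n) p) :=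
  inferInstanceAs (Module.Finite ℝ (EuclideanSpace ℝ (Fin n)))

/-- `f : Mⁿ → Sⁿ⁺¹` is a smooth immersed hypersurface: `f` is smooth and its differential is
injective at every point. -/
structure IsHypersurface (f : M → UnitSphere n) : Prop where
  contMDiff : ContMDiff (𝓡 n) (𝓡 (n + 1)) ∞ f
  injective_mfderiv : ∀ p : M, Function.Injective (mfderiv (𝓡 n) (𝓡 (n + 1)) f p)

/-- The differential at `p` of `f`, regarded as a map into the ambient Euclidean space. -/
def differential (f : M → UnitSphere n) (p : M) : TangentSpace (𝓡 n) p →L[ℝ] Ambient n :=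
  mvfderiv (𝓡 n) (fun q ↦ (f q : Ambient n)) p

/-- `ν` is a smooth unit normal field of `f` in the sphere over the open set `U ⊆ M`: it is
tangent to the sphere along `f` and orthogonal to the image of the differential of `f`. -/
structure IsUnitNormalOn (f : M → UnitSphere n) (ν : M → Ambient n) (U : Set M) : Prop where
  isOpen : IsOpen U
  contMDiffOn : ContMDiffOn (𝓡 n) 𝓘(ℝ, Ambient n) ∞ ν U
  norm_eq_one : ∀ p ∈ U, ‖ν p‖ = 1
  tangent_sphere : ∀ p ∈ U, inner ℝ (ν p) (f p : Ambient n) = 0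
  normal : ∀ p ∈ U, ∀ v : TangentSpace (𝓡 n) p, inner ℝ (ν p) (differential f p v) = 0

/-- The second fundamental form `A(v, w) = -⟨∇̄_v ν, df(w)⟩` at `p` with respect to a unit normal
field `ν` defined near `p`. The Levi-Civita derivative `∇̄_v ν` of the sphere is the part tangent
to the sphere of the Euclidean derivative of `ν`, so that the two have the same inner product
with `df(w)`. -/
def secondFundamentalForm (f : M → UnitSphere n) (ν : M → Ambient n) (p : M)
    (v w : TangentSpace (𝓡 n) p) : ℝ :=
  -inner ℝ (mvfderiv (𝓡 n) ν p v) (differential f p w)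

/-- The shape operator `S` at `p` with respect to a unit normal field `ν` defined near `p`,
given by `df(S v) = -dν(v)`; see `differential_shapeOperator`. -/
def shapeOperator (f : M → UnitSphere n) (ν : M → Ambient n) (p : M) :
    TangentSpace (𝓡 n) p →ₗ[ℝ] TangentSpace (𝓡 n) p :=
  -((differential f p : TangentSpace (𝓡 n) p →ₗ[ℝ] Ambient n).leftInverse ∘ₗ
    (mvfderiv (𝓡 n) ν p : TangentSpace (𝓡 n) p →ₗ[ℝ] Ambient n))

/-- The differential of a hypersurface into the ambient space is injective. -/
theorem IsHypersurface.injective_differential {f : M → UnitSphere n} (hf : IsHypersurface f)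
    (p : M) : Function.Injective (differential f p) := by
  have : Fact (Module.finrank ℝ (Ambient n) = n + 1 + 1) :=
    ⟨finrank_euclideanSpace_fin⟩
  have hc : MDifferentiableAt (𝓡 (n + 1)) 𝓘(ℝ, Ambient n)
      ((↑) : UnitSphere n → Ambient n) (f p) :=
    (contMDiff_coe_sphere (m := 1) (f p)).mdifferentiableAt one_ne_zero
  have hd := (hf.contMDiff p).mdifferentiableAt (by simp)
  have key : ∀ v, differential f p v =
      mvfderiv (𝓡 (n + 1)) ((↑) : UnitSphere n → Ambient n) (f p)
        (mfderiv (𝓡 n) (𝓡 (n + 1)) f p v) := fun v ↦ mfderiv_comp_apply p hc hd v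
  intro v w h
  rw [key, key] at h
  exact hf.injective_mfderiv p (injective_mvfderiv_subtypeVal_sphere (f p) h)

/-- Product rule for the inner product of two maps into the ambient space. -/
theorem inner_mvfderiv_of_const {a b : M → Ambient n} {p : M}
    (ha : MDifferentiableAt (𝓡 n) 𝓘(ℝ, Ambient n) a p)
    (hb : MDifferentiableAt (𝓡 n) 𝓘(ℝ, Ambient n) b p) {c : ℝ}
    (h : ∀ᶠ q in nhds p, inner ℝ (a q) (b q) = c) (v : TangentSpace (𝓡 n) p) :
    inner ℝ (a p) (mvfderiv (𝓡 n) b p v) + inner ℝ (mvfderiv (𝓡 n) a p v) (b p) = 0 := by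
  let A : EuclideanSpace ℝ (Fin n) →L[ℝ] Ambient n := mvfderiv (𝓡 n) a p
  let B : EuclideanSpace ℝ (Fin n) →L[ℝ] Ambient n := mvfderiv (𝓡 n) b p
  have h1 : HasFDerivWithinAt (fun x ↦ a ((extChartAt (𝓡 n) p).symm x)) A
      (Set.range (𝓡 n)) (extChartAt (𝓡 n) p p) := ha.hasMFDerivAt.2
  have h2 : HasFDerivWithinAt (fun x ↦ b ((extChartAt (𝓡 n) p).symm x)) B
      (Set.range (𝓡 n)) (extChartAt (𝓡 n) p p) := hb.hasMFDerivAt.2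
  rw [ModelWithCorners.range_eq_univ, hasFDerivWithinAt_univ] at h1 h2
  have h3 := (h1.inner ℝ h2).congr_of_eventuallyEq (f₁ := fun _ ↦ c) (by
    have := (continuousAt_extChartAt_symm (I := 𝓡 n) p).eventually (by simpa using h)
    filter_upwards [this] with q hq
    exact hq.symm)
  have h4 := DFunLike.congr_fun (h3.unique (hasFDerivAt_const c _)) v
  have h5 : inner ℝ (a ((extChartAt (𝓡 n) p).symm (extChartAt (𝓡 n) p p))) (B v) +
      inner ℝ (A v) (b ((extChartAt (𝓡 n) p).symm (extChartAt (𝓡 n) p p))) = 0 := h4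
  rwa [extChartAt_to_inv] at h5

/-- The defining (Weingarten) equation `df(S v) = -dν(v)` of the shape operator. -/
theorem differential_shapeOperator {f : M → UnitSphere n} (hf : IsHypersurface f)
    {ν : M → Ambient n} {U : Set M} (hν : IsUnitNormalOn f ν U) {p : M} (hp : p ∈ U)
    (v : TangentSpace (𝓡 n) p) :
    differential f p (shapeOperator f ν p v) = -mvfderiv (𝓡 n) ν p v := by
  have hn : ∀ᶠ q in nhds p, q ∈ U := hν.isOpen.mem_nhds hp
  have hdν : MDifferentiableAt (𝓡 n) 𝓘(ℝ, Ambient n) ν p :=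
    (hν.contMDiffOn.contMDiffAt hn).mdifferentiableAt (by simp)
  have hdf : MDifferentiableAt (𝓡 n) 𝓘(ℝ, Ambient n) (fun q ↦ (f q : Ambient n)) p :=
    have : Fact (Module.finrank ℝ (Ambient n) = n + 1 + 1) := ⟨finrank_euclideanSpace_fin⟩
    ((contMDiff_coe_sphere (m := 1) (f p)).mdifferentiableAt one_ne_zero).comp p
      ((hf.contMDiff p).mdifferentiableAt (by simp))
  have hff : ∀ w, inner ℝ (f p : Ambient n) (differential f p w) = 0 := fun w ↦ by
    have := inner_mvfderiv_of_const hdf hdf (c := 1) (.of_forall fun q ↦ by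
      simp) w
    rw [real_inner_comm (f p : Ambient n) (mvfderiv _ _ _ _)] at this
    change inner ℝ (f p : Ambient n) (mvfderiv (𝓡 n) (fun q ↦ (f q : Ambient n)) p w) = 0
    linarith
  have hνν : inner ℝ (ν p) (mvfderiv (𝓡 n) ν p v) = 0 := by
    have := inner_mvfderiv_of_const hdν hdν (c := 1) (hn.mono fun q hq ↦ by
      simp [hν.norm_eq_one q hq]) v
    rw [real_inner_comm (ν p) (mvfderiv _ _ _ _)] at this
    linarith
  have hfν : inner ℝ (f p : Ambient n) (mvfderiv (𝓡 n) ν p v) = 0 := by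
    have := inner_mvfderiv_of_const hdν hdf (c := 0)
      (hn.mono fun q hq ↦ hν.tangent_sphere q hq) v
    have h' : inner ℝ (ν p) (mvfderiv (𝓡 n) (fun q ↦ (f q : Ambient n)) p v) = 0 :=
      hν.normal p hp v
    rw [real_inner_comm]
    linarith
  have hon : Orthonormal ℝ ![(f p : Ambient n), ν p] := by
    rw [orthonormal_vecCons_iff]
    have := hν.tangent_sphere p hp
    rw [real_inner_comm] at this
    simp [hν.norm_eq_one p hp, this, Orthonormal]
  let V : Submodule ℝ (Ambient n) := Submodule.span ℝ (Set.range ![(f p : Ambient n), ν p])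
  have hV : Module.finrank ℝ V = 2 := by
    simpa using finrank_span_eq_card hon.linearIndependent
  have hV' := V.finrank_add_finrank_orthogonal
  rw [hV, finrank_euclideanSpace_fin] at hV'
  have hmem : ∀ x : Ambient n, inner ℝ (f p : Ambient n) x = 0 → inner ℝ (ν p) x = 0 → x ∈ Vᗮ :=
    fun x h1 h2 ↦ by
      rw [Submodule.mem_orthogonal]
      intro u hu
      induction hu using Submodule.span_induction with
      | mem u hu =>
        obtain ⟨i, rfl⟩ := hu
        fin_cases i
        · exact h1
        · exact h2
      | zero => simp
      | add a b _ _ ha hb => rw [inner_add_left, ha, hb, add_zero]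
      | smul c a _ ha => rw [inner_smul_left, ha, mul_zero]
  let L : EuclideanSpace ℝ (Fin n) →ₗ[ℝ] Ambient n := (differential f p).toLinearMap
  have hinj : LinearMap.ker L = ⊥ := LinearMap.ker_eq_bot.2 (hf.injective_differential p)
  have hrange : LinearMap.range L = Vᗮ := by
    apply Submodule.eq_of_le_of_finrank_eq
    · rintro _ ⟨w, rfl⟩
      exact hmem _ (hff w) (hν.normal p hp w)
    · rw [LinearMap.finrank_range_of_inj (LinearMap.ker_eq_bot.1 hinj),
        finrank_euclideanSpace_fin]
      omega
  have hin : mvfderiv (𝓡 n) ν p v ∈ LinearMap.range L := hrange ▸ hmem _ hfν hνν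
  obtain ⟨w, hw⟩ := hin
  let w' : TangentSpace (𝓡 n) p := w
  have hS : shapeOperator f ν p v = -w' := by
    change -(L.leftInverse (mvfderiv (𝓡 n) ν p v)) = -w
    rw [← hw, LinearMap.leftInverse_apply_of_inj hinj w]
  rw [hS, map_neg]
  exact congrArg _ hw

/-- The principal curvatures at `p`, listed with multiplicity: the eigenvalues of the shape
operator. -/
def principalCurvatures (f : M → UnitSphere n) (ν : M → Ambient n) (p : M) : Multiset ℝ :=
  (shapeOperator f ν p).charpoly.roots

/-- The mean curvature `H = (1/n) tr A`. -/
def meanCurvature (f : M → UnitSphere n) (ν : M → Ambient n) (p : M) : ℝ :=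
  (n : ℝ)⁻¹ * LinearMap.trace ℝ (TangentSpace (𝓡 n) p) (shapeOperator f ν p)

/-- The Gauss (Gauss-Kronecker) curvature `𝒦`: the determinant of the shape operator, that is,
the product of the principal curvatures. -/
def gaussCurvature (f : M → UnitSphere n) (ν : M → Ambient n) (p : M) : ℝ :=
  LinearMap.det (shapeOperator f ν p)

/-- The mean curvature vanishes identically. -/
def IsMinimal (f : M → UnitSphere n) : Prop :=
  ∀ (U : Set M) (ν : M → Ambient n), IsUnitNormalOn f ν U → ∀ p ∈ U, meanCurvature f ν p = 0

/-- The Gauss curvature vanishes identically. -/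
def HasZeroGaussCurvature (f : M → UnitSphere n) : Prop :=
  ∀ (U : Set M) (ν : M → Ambient n), IsUnitNormalOn f ν U → ∀ p ∈ U, gaussCurvature f ν p = 0

/-- The principal curvatures are constant: near every point there is a unit normal field
with respect to which the principal curvatures, with multiplicity, are the same fixed numbers.
No global unit normal field is required. -/
def IsIsoparametric (f : M → UnitSphere n) : Prop :=
  ∃ c : Multiset ℝ, ∀ p : M, ∃ (U : Set M) (ν : M → Ambient n),
    p ∈ U ∧ IsUnitNormalOn f ν U ∧ ∀ q ∈ U, principalCurvatures f ν q = c

/-- The second fundamental form vanishes identically. -/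
def IsTotallyGeodesic (f : M → UnitSphere n) : Prop :=
  ∀ (U : Set M) (ν : M → Ambient n), IsUnitNormalOn f ν U →
    ∀ p ∈ U, ∀ v w : TangentSpace (𝓡 n) p, secondFundamentalForm f ν p v w = 0

end SphereHypersurface

end

/-! The argument studies the image of the Gauss map `N` of the hypersurface `F`, working in a chart.
The map `N` collapses the directions in `ker S`. Its image has tangent space the range of `P`, has
`F` as a unit normal, and has as shape operator in the direction `F` the pseudo-inverse `R` of `S`.
Since the curvatures are constant, `tr R` and `tr R²` are constant.

Along a kernel field `X` the tangent space does not turn, and a shape operator is linear in the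
normal. Hence, with `ξ = dF X`, the derivative of `R` along `X` is the shape operator in the
direction `ξ`. Differentiating again along `X` gives `-‖ξ‖² R` plus the derivative of `R` along
another kernel vector (`exists_hasFDerivAt_fderiv_R`). Taking traces gives `tr R = 0`
(`trace_eq_zero`) and `tr ((D_X R)²) = ‖ξ‖² tr R²` (`trace_fderiv_sq`).

Zero Gauss curvature and minimality make the curvatures `0, a, b, d` with `a + b + d = 0`. If `a, b,
d` are all nonzero, `tr R = 0` reads `1/a + 1/b + 1/d = 0`, so `ab + bd + ad = 0` and `a² + b² + d²
= 0`, which is absurd (`sum_inv_eq_zero`). Otherwise the curvatures are `0, 0, a, -a`. If `a ≠ 0`,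
then `D_X R` is a symmetric `2 × 2` block whose diagonal vanishes by the constancy of the traces.
Its off-diagonal entry is linear in `ξ`, so it vanishes for some nonzero `ξ` in the two-dimensional
kernel, against `tr ((D_X R)²) = 2‖ξ‖²/a²` (`eq_zero_of_roots`). -/

open scoped Manifold ContDiff

noncomputable section

namespace SphereHypersurface

set_option linter.unusedSectionVars false

open Module

/-! ### Differential geometry of the image of the Gauss map. -/

section Focal

variable {E W : Type*} [NormedAddCommGroup E] [NormedSpace ℝ E]
  [NormedAddCommGroup W] [InnerProductSpace ℝ W]

/-- If two maps agree on an open set, so do their derivatives. -/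
theorem eq_of_hasFDerivAt_of_eqOn {V : Type*} [NormedAddCommGroup V] [NormedSpace ℝ V]
    {U : Set E} (hU : IsOpen U) {f g : E → V} (h : ∀ y ∈ U, f y = g y) {x : E} (hx : x ∈ U)
    {f' g' : E →L[ℝ] V} (hf : HasFDerivAt f f' x) (hg : HasFDerivAt g g' x) : f' = g' := by
  have : f =ᶠ[nhds x] g := by
    filter_upwards [hU.mem_nhds hx] with y hy using h y hy
  exact (hf.congr_of_eventuallyEq this.symm).unique hg

/-- A hypersurface `F` of the unit sphere with unit normal `N`, given over an open subset of a
vector space, together with the orthogonal projection `P` onto the image of `dN` and the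
pseudo-inverse `R` of the shape operator, both regarded as operators of the ambient space. -/
structure IsFocalFrame (U : Set E) (F N : E → W) (R P : E → W →L[ℝ] W) : Prop where
  isOpen : IsOpen U
  contDiffOn_F : ContDiffOn ℝ ∞ F U
  contDiffOn_N : ContDiffOn ℝ ∞ N U
  contDiffOn_R : ContDiffOn ℝ ∞ R U
  contDiffOn_P : ContDiffOn ℝ ∞ P U
  norm_F : ∀ x ∈ U, ‖F x‖ = 1
  inner_F_N : ∀ x ∈ U, inner ℝ (F x) (N x) = 0
  inner_N_fderiv : ∀ x ∈ U, ∀ v, inner ℝ (N x) (fderiv ℝ F x v) = 0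
  mem_range : ∀ x ∈ U, ∀ w, inner ℝ (F x) w = 0 → inner ℝ (N x) w = 0 →
    ∃ v, fderiv ℝ F x v = w
  P_comp_P : ∀ x ∈ U, P x ∘L P x = P x
  R_comp_P : ∀ x ∈ U, R x ∘L P x = R x
  P_symm : ∀ x ∈ U, ∀ a b, inner ℝ (P x a) b = inner ℝ a (P x b)
  P_F : ∀ x ∈ U, P x (F x) = 0
  P_fderiv_N : ∀ x ∈ U, ∀ v, P x (fderiv ℝ N x v) = fderiv ℝ N x v
  P_fderiv_F : ∀ x ∈ U, ∀ v, P x (fderiv ℝ F x v) = -R x (fderiv ℝ N x v)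
  range_P : ∀ x ∈ U, ∀ w, ∃ v, fderiv ℝ N x v = P x w
  ker_R : ∀ x ∈ U, ∀ w, R x w = 0 → P x w = 0

theorem two_le_infty : ((2 : ℕ∞) : WithTop ℕ∞) ≤ ∞ := WithTop.coe_le_coe.2 le_top

theorem hasFDerivAt_of_contDiffOn {V : Type*} [NormedAddCommGroup V] [NormedSpace ℝ V]
    {U : Set E} (hU : IsOpen U) {f : E → V} (h : ContDiffOn ℝ ∞ f U) {x : E} (hx : x ∈ U) :
    HasFDerivAt f (fderiv ℝ f x) x :=
  ((h.contDiffAt (hU.mem_nhds hx)).differentiableAt (by simp)).hasFDerivAt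

theorem hasFDerivAt_fderiv_of_contDiffOn {V : Type*} [NormedAddCommGroup V] [NormedSpace ℝ V]
    {U : Set E} (hU : IsOpen U) {f : E → V} (h : ContDiffOn ℝ ∞ f U) {x : E} (hx : x ∈ U) :
    HasFDerivAt (fderiv ℝ f) (fderiv ℝ (fderiv ℝ f) x) x :=
  (((h.contDiffAt (hU.mem_nhds hx)).fderiv_right (m := 1) two_le_infty
    ).differentiableAt (by simp)).hasFDerivAt

theorem fderiv_fderiv_symm {V : Type*} [NormedAddCommGroup V] [NormedSpace ℝ V]
    {U : Set E} (hU : IsOpen U) {f : E → V} (h : ContDiffOn ℝ ∞ f U) {x : E} (hx : x ∈ U)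
    (u v : E) : fderiv ℝ (fderiv ℝ f) x u v = fderiv ℝ (fderiv ℝ f) x v u :=
  ((h.contDiffAt (hU.mem_nhds hx)).isSymmSndFDerivAt
    (by simpa using two_le_infty)).eq u v

theorem inner_fderiv_self_of_norm_eq_one {U : Set E} (hU : IsOpen U) {f : E → W}
    (h : ContDiffOn ℝ ∞ f U) (h1 : ∀ x ∈ U, ‖f x‖ = 1) {x : E} (hx : x ∈ U) (v : E) :
    inner ℝ (f x) (fderiv ℝ f x v) = 0 := by
  have hf := hasFDerivAt_of_contDiffOn hU h hx
  have := eq_of_hasFDerivAt_of_eqOn hU (g := fun _ ↦ (1 : ℝ))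
    (fun y hy ↦ by rw [real_inner_self_eq_norm_sq, h1 y hy, one_pow]) hx (hf.inner ℝ hf)
    (hasFDerivAt_const _ _)
  have := DFunLike.congr_fun this v
  simp [fderivInnerCLM_apply] at this
  rw [real_inner_comm (f x)] at this
  linarith

namespace IsFocalFrame

variable {U : Set E} {F N : E → W} {R P : E → W →L[ℝ] W}

theorem inner_F_fderiv (h : IsFocalFrame U F N R P) {x : E} (hx : x ∈ U) (v : E) :
    inner ℝ (F x) (fderiv ℝ F x v) = 0 :=
  inner_fderiv_self_of_norm_eq_one h.isOpen h.contDiffOn_F h.norm_F hx v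

/-- In a direction in the kernel of `dN`, the projection `P` is stationary. -/
theorem fderiv_P_apply_eq_zero (h : IsFocalFrame U F N R P) {x : E} (hx : x ∈ U) {X : E}
    (hX : fderiv ℝ N x X = 0) : fderiv ℝ P x X = 0 := by
  have hP := hasFDerivAt_of_contDiffOn h.isOpen h.contDiffOn_P hx
  have hN' := hasFDerivAt_fderiv_of_contDiffOn h.isOpen h.contDiffOn_N hx
  -- Differentiate `P dN = dN`. With `X` in the second slot this puts `D²N(v, X)` in the range of
  -- `P`; by symmetry of `D²N`, the `X`-derivative of `P` then kills the image of `dN`.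
  have key : ∀ u v, fderiv ℝ P x u (fderiv ℝ N x v) + P x (fderiv ℝ (fderiv ℝ N) x u v) =
      fderiv ℝ (fderiv ℝ N) x u v := by
    intro u v
    have hv := hN'.clm_apply (hasFDerivAt_const v x)
    have := eq_of_hasFDerivAt_of_eqOn h.isOpen (fun y hy ↦ h.P_fderiv_N y hy v) hx
      (hP.clm_apply hv) hv
    have := DFunLike.congr_fun this u
    simp at this
    rw [add_comm]; exact this
  have h1 : ∀ v, fderiv ℝ P x X (fderiv ℝ N x v) = 0 := by
    intro v
    have e1 := key X v
    have e2 := key v X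
    rw [hX, map_zero, zero_add, fderiv_fderiv_symm h.isOpen h.contDiffOn_N hx] at e2
    rw [e2] at e1
    simpa using e1
  have h2 : ∀ w, fderiv ℝ P x X (P x w) = 0 := fun w ↦ by
    obtain ⟨v, hv⟩ := h.range_P x hx w
    rw [← hv, h1]
  have hsymm : ∀ a b, inner ℝ (fderiv ℝ P x X a) b = inner ℝ a (fderiv ℝ P x X b) := by
    intro a b
    have ha := hP.clm_apply (hasFDerivAt_const a x)
    have hb := hP.clm_apply (hasFDerivAt_const b x)
    have := eq_of_hasFDerivAt_of_eqOn h.isOpen (fun y hy ↦ h.P_symm y hy a b) hx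
      (ha.inner ℝ (hasFDerivAt_const b x)) ((hasFDerivAt_const a x).inner ℝ hb)
    have := DFunLike.congr_fun this X
    simpa [fderivInnerCLM_apply] using this
  have h3 : ∀ w, P x (fderiv ℝ P x X w) = 0 := fun w ↦ by
    refine ext_inner_right ℝ fun b ↦ ?_
    rw [h.P_symm x hx, hsymm, h2, inner_zero_right, inner_zero_left]
  -- Differentiating `P² = P` gives `P' = P' P + P P'`, and both terms have been shown to vanish.
  ext1 w
  have := eq_of_hasFDerivAt_of_eqOn h.isOpen (fun y hy ↦ h.P_comp_P y hy) hx
      (hP.clm_comp hP) hP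
  have := DFunLike.congr_fun (DFunLike.congr_fun this X) w
  simp [h2, h3] at this
  simpa using this.symm

/-- The Codazzi equation for the pseudo-inverse of the shape operator. -/
theorem fderiv_R_apply (h : IsFocalFrame U F N R P) {x : E} (hx : x ∈ U) {X : E}
    (hX : fderiv ℝ N x X = 0) (v : E) :
    fderiv ℝ R x X (fderiv ℝ N x v) = fderiv ℝ P x v (fderiv ℝ F x X) := by
  have hP := hasFDerivAt_of_contDiffOn h.isOpen h.contDiffOn_P hx
  have hR := hasFDerivAt_of_contDiffOn h.isOpen h.contDiffOn_R hx
  have hN' := hasFDerivAt_fderiv_of_contDiffOn h.isOpen h.contDiffOn_N hx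
  have hF' := hasFDerivAt_fderiv_of_contDiffOn h.isOpen h.contDiffOn_F hx
  have key : ∀ u v, P x (fderiv ℝ (fderiv ℝ F) x u v) + fderiv ℝ P x u (fderiv ℝ F x v) =
      -(R x (fderiv ℝ (fderiv ℝ N) x u v) + fderiv ℝ R x u (fderiv ℝ N x v)) := by
    intro u v
    have := eq_of_hasFDerivAt_of_eqOn h.isOpen (fun y hy ↦ h.P_fderiv_F y hy v) hx
      (hP.clm_apply (hF'.clm_apply (hasFDerivAt_const v x)))
      (hR.clm_apply (hN'.clm_apply (hasFDerivAt_const v x))).neg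
    simpa using DFunLike.congr_fun this u
  -- The two orders of differentiation share the terms with `D²F` and `D²N`; subtracting them leaves
  -- the Codazzi identity.
  have e1 := key X v
  have e2 := key v X
  rw [h.fderiv_P_apply_eq_zero hx hX] at e1
  rw [hX, fderiv_fderiv_symm h.isOpen h.contDiffOn_N hx,
    fderiv_fderiv_symm h.isOpen h.contDiffOn_F hx] at e2
  simp only [map_zero, add_zero, zero_apply] at e1 e2
  rw [e1] at e2
  rw [neg_add] at e2
  rw [add_assoc] at e2
  have := add_left_cancel (e2.trans (add_zero _).symm)
  rwa [neg_add_eq_zero] at this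

theorem fderiv_R_comp_P (h : IsFocalFrame U F N R P) {x : E} (hx : x ∈ U) {X : E}
    (hX : fderiv ℝ N x X = 0) : fderiv ℝ R x X ∘L P x = fderiv ℝ R x X := by
  have hP := hasFDerivAt_of_contDiffOn h.isOpen h.contDiffOn_P hx
  have hR := hasFDerivAt_of_contDiffOn h.isOpen h.contDiffOn_R hx
  have := eq_of_hasFDerivAt_of_eqOn h.isOpen (fun y hy ↦ h.R_comp_P y hy) hx
      (hR.clm_comp hP) hR
  ext1 w
  have := DFunLike.congr_fun (DFunLike.congr_fun this X) w
  simpa [h.fderiv_P_apply_eq_zero hx hX] using this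

/-- The second derivative of the pseudo-inverse of the shape operator along a field in the kernel
of the shape operator. -/
theorem exists_hasFDerivAt_fderiv_R (h : IsFocalFrame U F N R P) {X : E → E}
    (hXd : DifferentiableOn ℝ X U) (hX : ∀ x ∈ U, fderiv ℝ N x (X x) = 0) {x : E} (hx : x ∈ U) :
    ∃ (R'' : E →L[ℝ] W →L[ℝ] W) (Y : E), HasFDerivAt (fun y ↦ fderiv ℝ R y (X y)) R'' x ∧
      fderiv ℝ N x Y = 0 ∧
      R'' (X x) = -(‖fderiv ℝ F x (X x)‖ ^ 2) • R x + fderiv ℝ R x Y := by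
  have hP := hasFDerivAt_of_contDiffOn h.isOpen h.contDiffOn_P hx
  have hP' := hasFDerivAt_fderiv_of_contDiffOn h.isOpen h.contDiffOn_P hx
  have hR' := hasFDerivAt_fderiv_of_contDiffOn h.isOpen h.contDiffOn_R hx
  have hN' := hasFDerivAt_fderiv_of_contDiffOn h.isOpen h.contDiffOn_N hx
  have hF' := hasFDerivAt_fderiv_of_contDiffOn h.isOpen h.contDiffOn_F hx
  have hF := hasFDerivAt_of_contDiffOn h.isOpen h.contDiffOn_F hx
  have hN := hasFDerivAt_of_contDiffOn h.isOpen h.contDiffOn_N hx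
  have hXx := ((hXd x hx).differentiableAt (h.isOpen.mem_nhds hx)).hasFDerivAt
  obtain ⟨ξ', hξ⟩ : ∃ ξ', HasFDerivAt (fun y ↦ fderiv ℝ F y (X y)) ξ' x :=
    ⟨_, hF'.clm_apply hXx⟩
  obtain ⟨R'', hRX⟩ : ∃ R'', HasFDerivAt (fun y ↦ fderiv ℝ R y (X y)) R'' x :=
    ⟨_, hR'.clm_apply hXx⟩
  have hPX := h.fderiv_P_apply_eq_zero hx (hX x hx)
  have hRX0 := h.fderiv_R_comp_P hx (hX x hx)
  -- the components of the derivative of `dF X` along `X`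
  have a1 : P x (ξ' (X x)) = 0 := by
    have := eq_of_hasFDerivAt_of_eqOn h.isOpen (g := fun _ ↦ (0 : W))
      (fun y hy ↦ by rw [h.P_fderiv_F y hy, hX y hy, map_zero, neg_zero]) hx (hP.clm_apply hξ)
      (hasFDerivAt_const _ _)
    simpa [hPX] using DFunLike.congr_fun this (X x)
  have a2 : inner ℝ (F x) (ξ' (X x)) = -‖fderiv ℝ F x (X x)‖ ^ 2 := by
    have := eq_of_hasFDerivAt_of_eqOn h.isOpen (g := fun _ ↦ (0 : ℝ))
      (fun y hy ↦ h.inner_F_fderiv hy _) hx (hF.inner ℝ hξ) (hasFDerivAt_const _ _)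
    have := DFunLike.congr_fun this (X x)
    simp [fderivInnerCLM_apply] at this
    linarith
  have a3 : inner ℝ (N x) (ξ' (X x)) = 0 := by
    have := eq_of_hasFDerivAt_of_eqOn h.isOpen (g := fun _ ↦ (0 : ℝ))
      (fun y hy ↦ h.inner_N_fderiv y hy _) hx (hN.inner ℝ hξ) (hasFDerivAt_const _ _)
    have := DFunLike.congr_fun this (X x)
    simpa [fderivInnerCLM_apply, hX x hx] using this
  have hNF : inner ℝ (N x) (F x) = 0 := by rw [real_inner_comm]; exact h.inner_F_N x hx
  -- The only component along `F` or `N` of the derivative of `dF X` is `-‖dF X‖² F`. Once it is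
  -- removed the vector is tangent, and `a1` makes it a kernel direction.
  obtain ⟨Y, hY⟩ := h.mem_range x hx (ξ' (X x) + ‖fderiv ℝ F x (X x)‖ ^ 2 • F x)
    (by rw [inner_add_right, inner_smul_right, a2, real_inner_self_eq_norm_sq, h.norm_F x hx]
        ring)
    (by rw [inner_add_right, inner_smul_right, a3, hNF]; ring)
  have hNY : fderiv ℝ N x Y = 0 := by
    rw [← h.P_fderiv_N x hx]
    apply h.ker_R x hx
    rw [← neg_eq_zero, ← h.P_fderiv_F x hx, hY, map_add, a1, map_smul, h.P_F x hx]
    simp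
  refine ⟨R'', Y, hRX, hNY, ?_⟩
  -- Differentiate the Codazzi identity along `X`. The surplus second derivatives of `N` and `P` are
  -- expressed through `DX v` by differentiating `dN X = 0` and `D_X P = 0`; Codazzi at `DX v` then
  -- cancels them.
  have b1 : ∀ v, R'' (X x) (fderiv ℝ N x v) = fderiv ℝ P x v (ξ' (X x)) := by
    intro v
    have e1 := eq_of_hasFDerivAt_of_eqOn h.isOpen
      (fun y hy ↦ h.fderiv_R_apply hy (hX y hy) v) hx
      (hRX.clm_apply (hN'.clm_apply (hasFDerivAt_const v x)))
      ((hP'.clm_apply (hasFDerivAt_const v x)).clm_apply hξ)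
    have e1 := DFunLike.congr_fun e1 (X x)
    have e2 := eq_of_hasFDerivAt_of_eqOn h.isOpen (g := fun _ ↦ (0 : W →L[ℝ] W))
      (fun y hy ↦ h.fderiv_P_apply_eq_zero hy (hX y hy)) hx
      (hP'.clm_apply hXx) (hasFDerivAt_const _ _)
    have e2 := DFunLike.congr_fun (DFunLike.congr_fun e2 v) (fderiv ℝ F x (X x))
    have e3 := eq_of_hasFDerivAt_of_eqOn h.isOpen (g := fun _ ↦ (0 : W))
      (fun y hy ↦ hX y hy) hx (hN'.clm_apply hXx) (hasFDerivAt_const _ _)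
    have e3 := DFunLike.congr_fun e3 v
    have e4 := h.fderiv_R_apply hx (hX x hx) (fderiv ℝ X x v)
    simp at e1 e2 e3
    rw [fderiv_fderiv_symm h.isOpen h.contDiffOn_P hx] at e2
    rw [fderiv_fderiv_symm h.isOpen h.contDiffOn_N hx] at e3
    have e5 := congrArg (fderiv ℝ R x (X x)) e3
    rw [map_add, e4, map_zero, ← e2] at e5
    have e6 := add_left_cancel e5
    rw [e6] at e1
    exact add_left_cancel (e1.trans (add_comm _ _))
  have b2 : ∀ v, fderiv ℝ P x v (F x) = R x (fderiv ℝ N x v) := by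
    intro v
    have := eq_of_hasFDerivAt_of_eqOn h.isOpen (g := fun _ ↦ (0 : W))
      (fun y hy ↦ h.P_F y hy) hx (hP.clm_apply hF) (hasFDerivAt_const _ _)
    have := DFunLike.congr_fun this v
    simp [h.P_fderiv_F x hx] at this
    rwa [neg_add_eq_zero, eq_comm] at this
  have b3 : R'' (X x) ∘L P x = R'' (X x) := by
    have := eq_of_hasFDerivAt_of_eqOn h.isOpen
      (fun y hy ↦ h.fderiv_R_comp_P hy (hX y hy)) hx (hRX.clm_comp hP) hRX
    ext1 w
    have := DFunLike.congr_fun (DFunLike.congr_fun this (X x)) w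
    simpa [hPX] using this
  have b4 := h.fderiv_R_comp_P hx hNY
  -- All terms factor through `P`, so it is enough to compare them on the image of `dN`.
  rw [← b3, ← b4, ← h.R_comp_P x hx]
  ext1 w
  obtain ⟨v, hv⟩ := h.range_P x hx w
  have hξY : ξ' (X x) = fderiv ℝ F x Y - ‖fderiv ℝ F x (X x)‖ ^ 2 • F x := by
    rw [hY]; abel
  simp only [ContinuousLinearMap.comp_apply, add_apply,
    smul_apply, ← hv, b1]
  rw [hξY, map_sub, map_smul, b2, h.fderiv_R_apply hx hNY, neg_smul]
  abel

variable [FiniteDimensional ℝ W]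

/-- The trace, as a continuous linear functional on the operators of a finite-dimensional space. -/
def traceCLM (W : Type*) [NormedAddCommGroup W] [InnerProductSpace ℝ W] [FiniteDimensional ℝ W] :
    (W →L[ℝ] W) →L[ℝ] ℝ :=
  LinearMap.toContinuousLinearMap (LinearMap.trace ℝ W ∘ₗ ContinuousLinearMap.coeLM ℝ)

theorem traceCLM_apply (A : W →L[ℝ] W) : traceCLM W A = LinearMap.trace ℝ W A := rfl

theorem traceCLM_comp_comm (A B : W →L[ℝ] W) : traceCLM W (A ∘L B) = traceCLM W (B ∘L A) :=
  LinearMap.trace_mul_comm ℝ (A : W →ₗ[ℝ] W) (B : W →ₗ[ℝ] W)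

theorem traceCLM_fderiv_eq_zero (h : IsFocalFrame U F N R P) {t : ℝ}
    (ht : ∀ x ∈ U, traceCLM W (R x) = t) {x : E} (hx : x ∈ U) (X : E) :
    traceCLM W (fderiv ℝ R x X) = 0 := by
  have hR := hasFDerivAt_of_contDiffOn h.isOpen h.contDiffOn_R hx
  exact DFunLike.congr_fun (eq_of_hasFDerivAt_of_eqOn h.isOpen ht hx
    ((traceCLM W).hasFDerivAt.comp x hR) (hasFDerivAt_const t x)) X

theorem traceCLM_comp_fderiv_eq_zero (h : IsFocalFrame U F N R P) {t : ℝ}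
    (ht : ∀ x ∈ U, traceCLM W (R x ∘L R x) = t) {x : E} (hx : x ∈ U) (X : E) :
    traceCLM W (R x ∘L fderiv ℝ R x X) = 0 := by
  have hR := hasFDerivAt_of_contDiffOn h.isOpen h.contDiffOn_R hx
  have := DFunLike.congr_fun (eq_of_hasFDerivAt_of_eqOn h.isOpen ht hx
    ((traceCLM W).hasFDerivAt.comp x (hR.clm_comp hR)) (hasFDerivAt_const t x)) X
  simp at this
  rw [traceCLM_comp_comm (fderiv ℝ R x X)] at this
  linarith

/-- If the trace of the pseudo-inverse of the shape operator is constant and the shape operator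
has a kernel, then this trace vanishes. -/
theorem trace_eq_zero (h : IsFocalFrame U F N R P) {t : ℝ}
    (ht : ∀ x ∈ U, traceCLM W (R x) = t) {X : E → E}
    (hXd : DifferentiableOn ℝ X U) (hX : ∀ x ∈ U, fderiv ℝ N x (X x) = 0) {x : E} (hx : x ∈ U)
    (hx0 : fderiv ℝ F x (X x) ≠ 0) : t = 0 := by
  obtain ⟨R'', Y, hR'', -, hY⟩ := h.exists_hasFDerivAt_fderiv_R hXd hX hx
  -- The term with `Y` has zero trace, being a first derivative of the constant `tr R`; what remains
  -- is `-‖dF X‖² t = 0`.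
  have := DFunLike.congr_fun (eq_of_hasFDerivAt_of_eqOn h.isOpen
    (fun y hy ↦ h.traceCLM_fderiv_eq_zero ht hy (X y)) hx
    ((traceCLM W).hasFDerivAt.comp x hR'') (hasFDerivAt_const 0 x)) (X x)
  simp only [ContinuousLinearMap.comp_apply, hY, map_add, map_smul, ht x hx,
    h.traceCLM_fderiv_eq_zero ht hx] at this
  simpa [hx0] using this

/-- The derivative of the pseudo-inverse of the shape operator along the kernel of the shape
operator has a constant norm. -/
theorem trace_fderiv_sq (h : IsFocalFrame U F N R P) {t : ℝ}
    (ht : ∀ x ∈ U, traceCLM W (R x ∘L R x) = t) {X : E → E}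
    (hXd : DifferentiableOn ℝ X U) (hX : ∀ x ∈ U, fderiv ℝ N x (X x) = 0) {x : E} (hx : x ∈ U) :
    traceCLM W (fderiv ℝ R x (X x) ∘L fderiv ℝ R x (X x)) =
      ‖fderiv ℝ F x (X x)‖ ^ 2 * t := by
  obtain ⟨R'', Y, hR'', -, hY⟩ := h.exists_hasFDerivAt_fderiv_R hXd hX hx
  have hR := hasFDerivAt_of_contDiffOn h.isOpen h.contDiffOn_R hx
  -- Differentiate `tr (R D_X R) = 0` along `X`. The `Y`-term vanishes because `tr R²` is constant.
  have := DFunLike.congr_fun (eq_of_hasFDerivAt_of_eqOn h.isOpen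
    (fun y hy ↦ h.traceCLM_comp_fderiv_eq_zero ht hy (X y)) hx
    ((traceCLM W).hasFDerivAt.comp x (hR.clm_comp hR'')) (hasFDerivAt_const 0 x)) (X x)
  simp [hY, h.traceCLM_comp_fderiv_eq_zero ht hx, ht x hx] at this
  linarith

end IsFocalFrame
end Focal

/-! ### Eigenbases with prescribed eigenvalues, and polynomials in an operator. -/

section Eigenbasis

/-- Two finite families with the same multiset of values differ by a permutation. -/
theorem exists_perm_of_map_univ_eq {α : Type*} [LinearOrder α] {n : ℕ} {f g : Fin n → α}
    (h : Finset.univ.val.map f = Finset.univ.val.map g) :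
    ∃ σ : Equiv.Perm (Fin n), f ∘ σ = g := by
  have key : f ∘ Tuple.sort f = g ∘ Tuple.sort g := by
    rw [← List.ofFn_inj]
    refine List.Perm.eq_of_sortedLE (Tuple.monotone_sort f).sortedLE_ofFn
      (Tuple.monotone_sort g).sortedLE_ofFn ?_
    refine (Equiv.Perm.ofFn_comp_perm _ f).trans
      (List.Perm.trans ?_ (Equiv.Perm.ofFn_comp_perm _ g).symm)
    rw [Fin.univ_val_map, Fin.univ_val_map] at h
    exact Multiset.coe_eq_coe.1 h
  refine ⟨(Tuple.sort g).symm.trans (Tuple.sort f), ?_⟩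
  funext i
  have := congrFun key ((Tuple.sort g).symm i)
  simpa using this

variable {W : Type*} [NormedAddCommGroup W] [InnerProductSpace ℝ W] [FiniteDimensional ℝ W]

theorem exists_orthonormalBasis_of_roots {n : ℕ} (hn : finrank ℝ W = n) {T : W →ₗ[ℝ] W}
    (hT : T.IsSymmetric) {m : Fin n → ℝ} (h : T.charpoly.roots = Finset.univ.val.map m) :
    ∃ e : OrthonormalBasis (Fin n) ℝ W, ∀ i, T (e i) = m i • e i := by
  rw [hT.roots_charpoly_eq_eigenvalues hn] at h
  obtain ⟨σ, hσ⟩ := exists_perm_of_map_univ_eq h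
  refine ⟨(hT.eigenvectorBasis hn).reindex σ.symm, fun i ↦ ?_⟩
  rw [← hσ]
  simp

/-- A dimension count. It selects a kernel direction that is orthogonal to `F` and `N` and may
satisfy one further linear condition. -/
theorem exists_ne_zero_mem_span {k : ℕ} {u : Fin (k + 1) → W} (hu : LinearIndependent ℝ u)
    (L : W →ₗ[ℝ] (Fin k → ℝ)) : ∃ ξ ∈ Submodule.span ℝ (Set.range u), ξ ≠ 0 ∧ L ξ = 0 := by
  have : LinearMap.ker (L.domRestrict (Submodule.span ℝ (Set.range u))) ≠ ⊥ :=
    LinearMap.ker_ne_bot_of_finrank_lt (by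
      rw [finrank_span_eq_card hu]; simp)
  obtain ⟨ξ, hξ, h0⟩ := Submodule.exists_mem_ne_zero_of_ne_bot this
  exact ⟨ξ, ξ.2, by simpa using h0, by simpa using hξ⟩

variable {ι : Type*} [Fintype ι]

theorem inner_diagonal (e : OrthonormalBasis ι ℝ W) {A : W →L[ℝ] W} {k : ι → ℝ}
    (h : ∀ i, A (e i) = k i • e i) (a b : W) :
    inner ℝ (A a) b = inner ℝ a (A b) := by
  have key : ∀ a, A a = ∑ i, (inner ℝ (e i) a * k i) • e i := fun a ↦ by
    conv_lhs => rw [← e.sum_repr' a]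
    simp [map_sum, h, smul_smul]
  rw [key a, key b, sum_inner, inner_sum]
  refine Finset.sum_congr rfl fun i _ ↦ ?_
  rw [inner_smul_left, inner_smul_right, real_inner_comm a (e i)]
  simp; ring

theorem aeval_apply_eigenvector {T : W →L[ℝ] W} {c : ℝ} {w : W} (h : T w = c • w)
    (q : Polynomial ℝ) : Polynomial.aeval T q w = q.eval c • w := by
  induction q using Polynomial.induction_on' with
  | add p q hp hq => simp [hp, hq, add_smul]
  | monomial n a =>
    have : (T ^ n) w = c ^ n • w := by
      induction n with
      | zero => simp
      | succ n ih => rw [pow_succ', mul_apply_eq_comp, ih, map_smul, h, smul_smul]; rfl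
    simp [Polynomial.aeval_monomial, this, smul_smul, Algebra.algebraMap_eq_smul_one]

/-- Lagrange interpolation on the set of values, so repetitions are harmless, and `0⁻¹ = 0`
prescribes the value at `0`. Constant curvatures allow one polynomial for all points, which makes
the pseudo-inverse a smooth function of the shape operator. -/
theorem exists_polynomial_eval_eq_inv {ι : Type*} [Finite ι] (m : ι → ℝ) :
    ∃ q : Polynomial ℝ, ∀ i, q.eval (m i) = (m i)⁻¹ := by
  classical
  have hfin := Set.finite_range m
  refine ⟨Lagrange.interpolate hfin.toFinset id fun x ↦ x⁻¹, fun i ↦ ?_⟩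
  exact Lagrange.eval_interpolate_at_node (v := id) (fun x ↦ x⁻¹) (Set.injOn_id _) (by simp)

theorem contDiffOn_aeval {E : Type*} [NormedAddCommGroup E] [NormedSpace ℝ E] {U : Set E}
    {T : E → W →L[ℝ] W} (h : ContDiffOn ℝ ∞ T U) (q : Polynomial ℝ) :
    ContDiffOn ℝ ∞ (fun x ↦ Polynomial.aeval (T x) q) U := by
  simp only [Polynomial.aeval_eq_sum_range]
  exact ContDiffOn.sum fun i _ ↦ (h.pow i).const_smul _

end Eigenbasis

/-! ### Local hypersurfaces and their shape operator on the ambient space. -/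

section Euclidean

variable {E W : Type*} [NormedAddCommGroup E] [NormedSpace ℝ E] [FiniteDimensional ℝ E]
  [NormedAddCommGroup W] [InnerProductSpace ℝ W] [FiniteDimensional ℝ W]

/-- A hypersurface `F` of the unit sphere with unit normal field `N`, given over an open subset of
a vector space. -/
structure IsLocalHypersurface (U : Set E) (F N : E → W) : Prop where
  isOpen : IsOpen U
  finrank_eq : finrank ℝ W = finrank ℝ E + 2
  contDiffOn_F : ContDiffOn ℝ ∞ F U
  contDiffOn_N : ContDiffOn ℝ ∞ N U
  norm_F : ∀ x ∈ U, ‖F x‖ = 1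
  norm_N : ∀ x ∈ U, ‖N x‖ = 1
  inner_F_N : ∀ x ∈ U, inner ℝ (F x) (N x) = 0
  inner_N_fderiv : ∀ x ∈ U, ∀ v, inner ℝ (N x) (fderiv ℝ F x v) = 0
  injective : ∀ x ∈ U, Function.Injective (fderiv ℝ F x)

/-- The map `(v, s, t) ↦ D v + s a + t b`. -/
def adaptedFrame (D : E →L[ℝ] W) (a b : W) : E × ℝ × ℝ →L[ℝ] W :=
  D.coprod ((ContinuousLinearMap.toSpanSingleton ℝ a).coprod
    (ContinuousLinearMap.toSpanSingleton ℝ b))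

theorem adaptedFrame_apply (D : E →L[ℝ] W) (a b : W) (v : E) (s t : ℝ) :
    adaptedFrame D a b (v, s, t) = D v + (s • a + t • b) := by
  simp [adaptedFrame]

/-- Pairing with `a` and `b` isolates `s` and `t`, so the map is injective; the dimensions agree. -/
theorem isInvertible_adaptedFrame (hW : finrank ℝ W = finrank ℝ E + 2) {D : E →L[ℝ] W} {a b : W}
    (hD : Function.Injective D) (ha : ‖a‖ = 1) (hb : ‖b‖ = 1) (hab : inner ℝ a b = 0)
    (haD : ∀ v, inner ℝ a (D v) = 0) (hbD : ∀ v, inner ℝ b (D v) = 0) :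
    (adaptedFrame D a b).IsInvertible := by
  have hinj : Function.Injective (adaptedFrame D a b : E × ℝ × ℝ →ₗ[ℝ] W) := by
    rw [← LinearMap.ker_eq_bot, LinearMap.ker_eq_bot']
    rintro ⟨v, s, t⟩ h
    change adaptedFrame D a b (v, s, t) = 0 at h
    rw [adaptedFrame_apply] at h
    have hba : inner ℝ b a = 0 := by rw [real_inner_comm]; exact hab
    have h1 := congrArg (inner ℝ a) h
    have h2 := congrArg (inner ℝ b) h
    simp [inner_add_right, inner_smul_right, haD, hbD, hab, hba, ha, hb] at h1 h2
    subst h1 h2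
    simp at h
    have := hD (h.trans (map_zero D).symm)
    simp [this]
  let e := LinearEquiv.ofInjectiveOfFinrankEq (adaptedFrame D a b : E × ℝ × ℝ →ₗ[ℝ] W) hinj
    (by simp [hW])
  refine ⟨e.toContinuousLinearEquiv, ?_⟩
  exact ContinuousLinearMap.ext fun w ↦ rfl

/-- The component in `E` of a vector with respect to an adapted frame. -/
def tangentPart (F N : E → W) (x : E) : W →L[ℝ] E :=
  ContinuousLinearMap.fst ℝ E (ℝ × ℝ) ∘L (adaptedFrame (fderiv ℝ F x) (F x) (N x)).inverse

/-- The shape operator, regarded as an operator of the ambient space vanishing on the normal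
space. -/
def ambientShape (F N : E → W) (x : E) : W →L[ℝ] W :=
  -(fderiv ℝ N x ∘L tangentPart F N x)

namespace IsLocalHypersurface

variable {U : Set E} {F N : E → W}

theorem inner_F_fderiv (h : IsLocalHypersurface U F N) {x : E} (hx : x ∈ U) (v : E) :
    inner ℝ (F x) (fderiv ℝ F x v) = 0 :=
  inner_fderiv_self_of_norm_eq_one h.isOpen h.contDiffOn_F h.norm_F hx v

theorem isInvertible (h : IsLocalHypersurface U F N) {x : E} (hx : x ∈ U) :
    (adaptedFrame (fderiv ℝ F x) (F x) (N x)).IsInvertible :=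
  isInvertible_adaptedFrame h.finrank_eq (h.injective x hx) (h.norm_F x hx) (h.norm_N x hx)
    (h.inner_F_N x hx) (h.inner_F_fderiv hx) (h.inner_N_fderiv x hx)

theorem tangentPart_adaptedFrame (h : IsLocalHypersurface U F N) {x : E} (hx : x ∈ U) (v : E)
    (s t : ℝ) : tangentPart F N x (fderiv ℝ F x v + (s • F x + t • N x)) = v := by
  rw [← adaptedFrame_apply, tangentPart, ContinuousLinearMap.comp_apply,
    (h.isInvertible hx).inverse_apply_self]
  rfl

theorem tangentPart_fderiv (h : IsLocalHypersurface U F N) {x : E} (hx : x ∈ U) (v : E) :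
    tangentPart F N x (fderiv ℝ F x v) = v := by
  simpa using h.tangentPart_adaptedFrame hx v 0 0

theorem tangentPart_F (h : IsLocalHypersurface U F N) {x : E} (hx : x ∈ U) :
    tangentPart F N x (F x) = 0 := by
  simpa using h.tangentPart_adaptedFrame hx 0 1 0

theorem tangentPart_N (h : IsLocalHypersurface U F N) {x : E} (hx : x ∈ U) :
    tangentPart F N x (N x) = 0 := by
  simpa using h.tangentPart_adaptedFrame hx 0 0 1

theorem exists_eq (h : IsLocalHypersurface U F N) {x : E} (hx : x ∈ U) (w : W) :
    ∃ (v : E) (s t : ℝ), w = fderiv ℝ F x v + (s • F x + t • N x) := by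
  obtain ⟨⟨v, s, t⟩, hv⟩ := (h.isInvertible hx).bijective.surjective w
  exact ⟨v, s, t, by rw [← hv, adaptedFrame_apply]⟩

theorem fderiv_tangentPart (h : IsLocalHypersurface U F N) {x : E} (hx : x ∈ U) {w : W}
    (h1 : inner ℝ (F x) w = 0) (h2 : inner ℝ (N x) w = 0) :
    fderiv ℝ F x (tangentPart F N x w) = w := by
  obtain ⟨v, s, t, rfl⟩ := h.exists_eq hx w
  have hNF : inner ℝ (N x) (F x) = 0 := by rw [real_inner_comm]; exact h.inner_F_N x hx
  simp [inner_add_right, inner_smul_right, h.inner_F_fderiv hx, h.inner_N_fderiv x hx, hNF,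
    h.inner_F_N x hx, h.norm_F x hx, h.norm_N x hx] at h1 h2
  rw [h.tangentPart_adaptedFrame hx, h1, h2]
  simp

theorem ambientShape_fderiv (h : IsLocalHypersurface U F N) {x : E} (hx : x ∈ U) (v : E) :
    ambientShape F N x (fderiv ℝ F x v) = -fderiv ℝ N x v := by
  simp [ambientShape, h.tangentPart_fderiv hx]

theorem ambientShape_F (h : IsLocalHypersurface U F N) {x : E} (hx : x ∈ U) :
    ambientShape F N x (F x) = 0 := by
  simp [ambientShape, h.tangentPart_F hx]

theorem ambientShape_N (h : IsLocalHypersurface U F N) {x : E} (hx : x ∈ U) :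
    ambientShape F N x (N x) = 0 := by
  simp [ambientShape, h.tangentPart_N hx]

theorem contDiffOn_tangentPart (h : IsLocalHypersurface U F N) :
    ContDiffOn ℝ ∞ (tangentPart F N) U := by
  intro x hx
  refine ContDiffAt.contDiffWithinAt ?_
  have hF := h.contDiffOn_F.contDiffAt (h.isOpen.mem_nhds hx)
  have hN := h.contDiffOn_N.contDiffAt (h.isOpen.mem_nhds hx)
  have hF' : ContDiffAt ℝ ∞ (fderiv ℝ F) x := hF.fderiv_right (by simp)
  have hG : ContDiffAt ℝ ∞ (fun y ↦ adaptedFrame (fderiv ℝ F y) (F y) (N y)) x := by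
    -- Written as a sum of compositions and `smulRight`s, the frame visibly depends smoothly on `y`;
    -- inversion is smooth at invertible maps.
    have e : (fun y ↦ adaptedFrame (fderiv ℝ F y) (F y) (N y)) = fun y ↦
        fderiv ℝ F y ∘L ContinuousLinearMap.fst ℝ E (ℝ × ℝ) +
        ((ContinuousLinearMap.fst ℝ ℝ ℝ ∘L ContinuousLinearMap.snd ℝ E (ℝ × ℝ)).smulRight (F y) +
        (ContinuousLinearMap.snd ℝ ℝ ℝ ∘L ContinuousLinearMap.snd ℝ E (ℝ × ℝ)).smulRight (N y))
        := by
      funext y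
      refine ContinuousLinearMap.ext fun ⟨v, s, t⟩ ↦ ?_
      simp [adaptedFrame_apply]
    rw [e]
    exact (hF'.clm_comp contDiffAt_const).add
      ((contDiffAt_const.smulRight hF).add (contDiffAt_const.smulRight hN))
  have hG' : ContDiffAt ℝ ∞ (fun y ↦ (adaptedFrame (fderiv ℝ F y) (F y) (N y)).inverse) x :=
    ContDiffAt.comp (g := ContinuousLinearMap.inverse) x
      (h.isInvertible hx).contDiffAt_map_inverse hG
  exact contDiffAt_const.clm_comp hG'

theorem contDiffOn_ambientShape (h : IsLocalHypersurface U F N) :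
    ContDiffOn ℝ ∞ (ambientShape F N) U := by
  have hN' : ContDiffOn ℝ ∞ (fderiv ℝ N) U := fun x hx ↦
    ((h.contDiffOn_N.contDiffAt (h.isOpen.mem_nhds hx)).fderiv_right
      (by simp)).contDiffWithinAt
  exact (hN'.clm_comp h.contDiffOn_tangentPart).neg

theorem inner_fderiv_fderiv (h : IsLocalHypersurface U F N) {x : E} (hx : x ∈ U) (v w : E) :
    inner ℝ (fderiv ℝ N x v) (fderiv ℝ F x w) =
      -inner ℝ (N x) (fderiv ℝ (fderiv ℝ F) x v w) := by
  have hN := hasFDerivAt_of_contDiffOn h.isOpen h.contDiffOn_N hx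
  have hF' := hasFDerivAt_fderiv_of_contDiffOn h.isOpen h.contDiffOn_F hx
  have := eq_of_hasFDerivAt_of_eqOn h.isOpen (g := fun _ ↦ (0 : ℝ))
    (fun y hy ↦ h.inner_N_fderiv y hy w) hx (hN.inner ℝ (hF'.clm_apply (hasFDerivAt_const w x)))
    (hasFDerivAt_const _ _)
  have := DFunLike.congr_fun this v
  simp [fderivInnerCLM_apply] at this
  linarith

theorem inner_fderiv_N_self (h : IsLocalHypersurface U F N) {x : E} (hx : x ∈ U) (v : E) :
    inner ℝ (N x) (fderiv ℝ N x v) = 0 :=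
  inner_fderiv_self_of_norm_eq_one h.isOpen h.contDiffOn_N h.norm_N hx v

theorem inner_F_fderiv_N (h : IsLocalHypersurface U F N) {x : E} (hx : x ∈ U) (v : E) :
    inner ℝ (F x) (fderiv ℝ N x v) = 0 := by
  have hN := hasFDerivAt_of_contDiffOn h.isOpen h.contDiffOn_N hx
  have hF := hasFDerivAt_of_contDiffOn h.isOpen h.contDiffOn_F hx
  have := eq_of_hasFDerivAt_of_eqOn h.isOpen (g := fun _ ↦ (0 : ℝ))
    (fun y hy ↦ h.inner_F_N y hy) hx (hF.inner ℝ hN) (hasFDerivAt_const _ _)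
  have := DFunLike.congr_fun this v
  simp [fderivInnerCLM_apply] at this
  rw [real_inner_comm (N x), h.inner_N_fderiv x hx] at this
  linarith

/-- On tangent vectors this is the symmetry of `D²F`, paired with `N`; since `dN` is orthogonal to
`F` and `N`, the normal plane contributes nothing. -/
theorem isSymmetric_ambientShape (h : IsLocalHypersurface U F N) {x : E} (hx : x ∈ U) :
    (ambientShape F N x : W →ₗ[ℝ] W).IsSymmetric := by
  intro a b
  obtain ⟨v, s, t, rfl⟩ := h.exists_eq hx a
  obtain ⟨v', s', t', rfl⟩ := h.exists_eq hx b
  have e1 : ∀ u u', inner ℝ (fderiv ℝ N x u) (fderiv ℝ F x u') =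
      inner ℝ (fderiv ℝ N x u') (fderiv ℝ F x u) := fun u u' ↦ by
    rw [h.inner_fderiv_fderiv hx, h.inner_fderiv_fderiv hx,
      fderiv_fderiv_symm h.isOpen h.contDiffOn_F hx]
  have e2 : ∀ u, inner ℝ (fderiv ℝ N x u) (F x) = 0 := fun u ↦ by
    rw [real_inner_comm, h.inner_F_fderiv_N hx]
  have e3 : ∀ u, inner ℝ (fderiv ℝ N x u) (N x) = 0 := fun u ↦ by
    rw [real_inner_comm, h.inner_fderiv_N_self hx]
  simp [h.ambientShape_fderiv hx, h.ambientShape_F hx, h.ambientShape_N hx, inner_add_right,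
    inner_add_left, inner_smul_left, inner_smul_right, e2, e3, h.inner_F_fderiv_N hx,
    h.inner_fderiv_N_self hx]
  rw [e1, real_inner_comm]

/-- A hypersurface with constant principal curvatures carries the smooth pseudo-inverse of its
shape operator. -/
theorem exists_isFocalFrame (h : IsLocalHypersurface U F N) {ι : Type*} [Fintype ι]
    {m : ι → ℝ}
    (hm : ∀ x ∈ U, ∃ e : OrthonormalBasis ι ℝ W, ∀ i, ambientShape F N x (e i) = m i • e i) :
    ∃ R : E → W →L[ℝ] W, IsFocalFrame U F N R (fun x ↦ ambientShape F N x ∘L R x) ∧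
      (∀ x ∈ U, ∀ (c : ι) w, ambientShape F N x w = m c • w → R x w = (m c)⁻¹ • w) ∧
      ∀ x ∈ U, ambientShape F N x ∘L R x ∘L ambientShape F N x = ambientShape F N x := by
  obtain ⟨q, hq⟩ := exists_polynomial_eval_eq_inv m
  let R : E → W →L[ℝ] W := fun x ↦ Polynomial.aeval (ambientShape F N x) q
  have hR : ∀ x, ∀ (c : ι) w, ambientShape F N x w = m c • w → R x w = (m c)⁻¹ • w :=
    fun x c w hw ↦ by rw [← hq, ← aeval_apply_eigenvector hw]
  have hTR : ∀ x w, ambientShape F N x (R x w) = R x (ambientShape F N x w) := fun x w ↦ by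
    have := congrArg (Polynomial.aeval (ambientShape F N x)) (mul_comm Polynomial.X q)
    rw [map_mul, map_mul, Polynomial.aeval_X] at this
    exact DFunLike.congr_fun this w
  have hTRT : ∀ x ∈ U, ∀ w, ambientShape F N x (R x (ambientShape F N x w)) =
      ambientShape F N x w := fun x hx w ↦ by
    obtain ⟨e, he⟩ := hm x hx
    suffices ambientShape F N x ∘L R x ∘L ambientShape F N x = ambientShape F N x from
      DFunLike.congr_fun this w
    apply ContinuousLinearMap.coe_injective
    refine e.toBasis.ext fun i ↦ ?_
    -- On an eigenvector this is `m m⁻¹ m = m`, valid also for `m = 0`.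
    by_cases h0 : m i = 0 <;> simp [he, hR x i _ (he i), smul_smul, h0]
  have hRTR : ∀ x ∈ U, ∀ w, R x (ambientShape F N x (R x w)) = R x w := fun x hx w ↦ by
    obtain ⟨e, he⟩ := hm x hx
    suffices R x ∘L ambientShape F N x ∘L R x = R x from DFunLike.congr_fun this w
    apply ContinuousLinearMap.coe_injective
    refine e.toBasis.ext fun i ↦ ?_
    by_cases h0 : m i = 0 <;> simp [he, hR x i _ (he i), smul_smul, h0]
  have hRs : ContDiffOn ℝ ∞ R U := contDiffOn_aeval h.contDiffOn_ambientShape q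
  refine ⟨R, ?_, fun x _ ↦ hR x, fun x hx ↦ by ext1 w; exact hTRT x hx w⟩
  exact
    { isOpen := h.isOpen
      contDiffOn_F := h.contDiffOn_F
      contDiffOn_N := h.contDiffOn_N
      contDiffOn_R := hRs
      contDiffOn_P := h.contDiffOn_ambientShape.clm_comp hRs
      norm_F := h.norm_F
      inner_F_N := h.inner_F_N
      inner_N_fderiv := h.inner_N_fderiv
      mem_range := fun x hx w h1 h2 ↦ ⟨_, h.fderiv_tangentPart hx h1 h2⟩
      P_comp_P := fun x hx ↦ by
        ext1 w; exact congrArg (ambientShape F N x) (hRTR x hx w)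
      R_comp_P := fun x hx ↦ by ext1 w; exact hRTR x hx w
      P_symm := fun x hx a b ↦ by
        obtain ⟨e, he⟩ := hm x hx
        refine inner_diagonal e (k := fun i ↦ (m i)⁻¹ * m i) (fun i ↦ ?_) a b
        simp [he, hR x i _ (he i), smul_smul]
      P_F := fun x hx ↦ by
        simp [hTR, h.ambientShape_F hx]
      P_fderiv_N := fun x hx v ↦ by
        have := hTRT x hx (fderiv ℝ F x v)
        rw [h.ambientShape_fderiv hx] at this
        simpa using this
      P_fderiv_F := fun x hx v ↦ by
        simp [hTR, h.ambientShape_fderiv hx]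
      range_P := fun x hx w ↦ ⟨-tangentPart F N x (R x w), by simp [ambientShape]⟩
      ker_R := fun x hx w hw ↦ by simp [hw] }

end IsLocalHypersurface

end Euclidean

/-! ### Constraints on constant principal curvatures. -/

section Rigidity

variable {E W : Type*} [NormedAddCommGroup E] [NormedSpace ℝ E] [FiniteDimensional ℝ E]
  [NormedAddCommGroup W] [InnerProductSpace ℝ W] [FiniteDimensional ℝ W]

/-- In the frame `G` the operator is block diagonal, with blocks `S` and `0`; the factor `X ^ 2`
comes from the normal plane. -/
theorem charpoly_of_adaptedFrame {V : Type*} [AddCommGroup V] [Module ℝ V]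
    [Module.Finite ℝ V] (G : (V × ℝ × ℝ) ≃ₗ[ℝ] W) (S : V →ₗ[ℝ] V) (T : W →ₗ[ℝ] W)
    (h : ∀ v s t, T (G (v, s, t)) = G (S v, 0, 0)) :
    T.charpoly = S.charpoly * Polynomial.X ^ 2 := by
  have hT : T = G.conj (S.prodMap (0 : ℝ × ℝ →ₗ[ℝ] ℝ × ℝ)) := by
    ext w
    obtain ⟨⟨v, s, t⟩, rfl⟩ := G.surjective w
    rw [h, LinearEquiv.conj_apply_apply]
    simp
  have h0 : (0 : ℝ × ℝ →ₗ[ℝ] ℝ × ℝ).charpoly = Polynomial.X ^ 2 := by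
    rw [LinearMap.charpoly_zero]; simp
  rw [hT, LinearEquiv.charpoly_conj, LinearMap.charpoly_prodMap, h0]

namespace IsLocalHypersurface

variable {U : Set E} {F N : E → W}

theorem traceCLM_eq_sum {n : ℕ} (e : OrthonormalBasis (Fin n) ℝ W) (A : W →L[ℝ] W) :
    IsFocalFrame.traceCLM W A = ∑ i, inner ℝ (e i) (A (e i)) := by
  rw [IsFocalFrame.traceCLM_apply, LinearMap.trace_eq_sum_inner _ e]
  rfl

/-- Every vector in the kernel of the shape operator at a point extends to a smooth field in the
kernel. -/
theorem exists_kernel_field (h : IsLocalHypersurface U F N) {R : E → W →L[ℝ] W}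
    (hR : IsFocalFrame U F N R (fun x ↦ ambientShape F N x ∘L R x))
    (hTRT : ∀ x ∈ U, ambientShape F N x ∘L R x ∘L ambientShape F N x = ambientShape F N x)
    {x : E} (hx : x ∈ U) {ξ : W} (h1 : inner ℝ (F x) ξ = 0) (h2 : inner ℝ (N x) ξ = 0)
    (hξ : ambientShape F N x ξ = 0) :
    ∃ X : E → E, DifferentiableOn ℝ X U ∧ (∀ y ∈ U, fderiv ℝ N y (X y) = 0) ∧
      X x = tangentPart F N x ξ ∧ fderiv ℝ F x (X x) = ξ := by
  have hT : ∀ {y}, y ∈ U → DifferentiableWithinAt ℝ (ambientShape F N) U y := fun hy ↦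
    (h.contDiffOn_ambientShape.differentiableOn (by simp)) _ hy
  have hRd : ∀ {y}, y ∈ U → DifferentiableWithinAt ℝ R U y := fun hy ↦
    (hR.contDiffOn_R.differentiableOn (by simp)) _ hy
  have hx' : tangentPart F N x (ξ - R x (ambientShape F N x ξ)) = tangentPart F N x ξ := by
    simp [hξ]
  -- For `T` the ambient shape operator, `T R T = T` says that `1 - R T` maps into `ker T`; it fixes
  -- `ξ` at `x`.
  refine ⟨fun y ↦ tangentPart F N y (ξ - R y (ambientShape F N y ξ)), fun y hy ↦ ?_,
    fun y hy ↦ ?_, hx', ?_⟩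
  · have hP : DifferentiableWithinAt ℝ (tangentPart F N) U y :=
      (h.contDiffOn_tangentPart.differentiableOn (by simp)) _ hy
    exact hP.clm_apply ((differentiableWithinAt_const ξ).sub
      ((hRd hy).clm_apply ((hT hy).clm_apply (differentiableWithinAt_const ξ))))
  · have := DFunLike.congr_fun (hTRT y hy) ξ
    simp only [ContinuousLinearMap.comp_apply] at this
    rw [← neg_eq_zero]
    change ambientShape F N y (ξ - R y (ambientShape F N y ξ)) = 0
    rw [map_sub, this, sub_self]
  · exact (congrArg _ hx').trans (h.fderiv_tangentPart hx h1 h2)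

theorem exists_orthonormalBasis (h : IsLocalHypersurface U F N) (hW : finrank ℝ W = 6)
    {m : Fin 6 → ℝ} (hm : ∀ x ∈ U, (ambientShape F N x : W →ₗ[ℝ] W).charpoly.roots =
      Finset.univ.val.map m) :
    ∀ x ∈ U, ∃ e : OrthonormalBasis (Fin 6) ℝ W, ∀ i, ambientShape F N x (e i) = m i • e i :=
  fun x hx ↦ exists_orthonormalBasis_of_roots hW (h.isSymmetric_ambientShape hx) (hm x hx)

theorem apply_eq_zero_of_mem_span {ι : Type*} {T : W →L[ℝ] W} {u : ι → W} (hu : ∀ i, T (u i) = 0)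
    {ξ : W} (hξ : ξ ∈ Submodule.span ℝ (Set.range u)) : T ξ = 0 := by
  have : Submodule.span ℝ (Set.range u) ≤ LinearMap.ker (T : W →ₗ[ℝ] W) := by
    rw [Submodule.span_le]
    rintro _ ⟨i, rfl⟩
    exact hu i
  exact this hξ

/-- The sum is the constant `tr R`, which vanishes because the shape operator has a tangent kernel
direction. Zero curvatures contribute `0⁻¹ = 0`. -/
theorem sum_inv_eq_zero (h : IsLocalHypersurface U F N) (hW : finrank ℝ W = 6)
    {a b d : ℝ} (hm : ∀ x ∈ U, (ambientShape F N x : W →ₗ[ℝ] W).charpoly.roots =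
      {0, 0, 0, a, b, d}) (hU : U.Nonempty) : a⁻¹ + b⁻¹ + d⁻¹ = 0 := by
  obtain ⟨x, hx⟩ := hU
  have he := h.exists_orthonormalBasis hW (m := ![0, 0, 0, a, b, d]) (fun y hy ↦ by
    rw [hm y hy]; rfl)
  obtain ⟨R, hR, hRe, hTRT⟩ := h.exists_isFocalFrame he
  obtain ⟨e, hex⟩ := he x hx
  -- The eigenbasis need not contain `F` and `N`. Among three independent null vectors, the two
  -- orthogonality conditions leave a nonzero tangent one.
  obtain ⟨ξ, hξ, hξ0, hL⟩ := exists_ne_zero_mem_span (k := 2) (u := e ∘ Fin.castLE (by simp))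
    (e.orthonormal.linearIndependent.comp _ (Fin.castLE_injective _))
    (LinearMap.pi ![(innerSL ℝ (F x) : W →ₗ[ℝ] ℝ), (innerSL ℝ (N x) : W →ₗ[ℝ] ℝ)])
  obtain ⟨X, hXd, hX, -, hX0⟩ := h.exists_kernel_field hR hTRT hx
    (by simpa using congrFun hL 0) (by simpa using congrFun hL 1)
    (apply_eq_zero_of_mem_span (fun i ↦ by
      rw [Function.comp_apply, hex]; fin_cases i <;> simp) hξ)
  refine hR.trace_eq_zero (fun y hy ↦ ?_) hXd hX hx (hX0 ▸ hξ0)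
  obtain ⟨e', he'⟩ := he y hy
  rw [traceCLM_eq_sum e']
  simp [hRe y hy _ _ (he' _), Fin.sum_univ_succ, inner_smul_right]
  ring

theorem eq_zero_of_roots (h : IsLocalHypersurface U F N) (hW : finrank ℝ W = 6)
    {a : ℝ} (hm : ∀ x ∈ U, (ambientShape F N x : W →ₗ[ℝ] W).charpoly.roots =
      {0, 0, 0, 0, a, -a}) (hU : U.Nonempty) : a = 0 := by
  by_contra ha
  obtain ⟨x, hx⟩ := hU
  have he := h.exists_orthonormalBasis hW (m := ![0, 0, 0, 0, a, -a]) (fun y hy ↦ by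
    rw [hm y hy]; rfl)
  obtain ⟨R, hR, hRe, hTRT⟩ := h.exists_isFocalFrame he
  obtain ⟨e, hex⟩ := he x hx
  -- Four null vectors leave room for a third condition: the vanishing of the off-diagonal entry of
  -- `D_X R`.
  obtain ⟨ξ, hξ, hξ0, hL⟩ := exists_ne_zero_mem_span (k := 3) (u := e ∘ Fin.castLE (by simp))
    (e.orthonormal.linearIndependent.comp _ (Fin.castLE_injective _))
    (LinearMap.pi ![(innerSL ℝ (F x) : W →ₗ[ℝ] ℝ), (innerSL ℝ (N x) : W →ₗ[ℝ] ℝ),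
      (innerSL ℝ (e 5) ∘L ContinuousLinearMap.apply ℝ W (e 4) ∘L fderiv ℝ R x ∘L
        tangentPart F N x : W →L[ℝ] ℝ)])
  obtain ⟨X, hXd, hX, hXt, hX0⟩ := h.exists_kernel_field hR hTRT hx
    (by simpa using congrFun hL 0) (by simpa using congrFun hL 1)
    (apply_eq_zero_of_mem_span (fun i ↦ by
      rw [Function.comp_apply, hex]; fin_cases i <;> simp) hξ)
  have h54 : inner ℝ (e 5) (fderiv ℝ R x (X x) (e 4)) = 0 := by
    rw [hXt]; simpa using congrFun hL 2
  have ht : ∀ y ∈ U, IsFocalFrame.traceCLM W (R y) = 0 := fun y hy ↦ by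
    obtain ⟨e', he'⟩ := he y hy
    rw [traceCLM_eq_sum e']
    simp [hRe y hy _ _ (he' _), Fin.sum_univ_succ, inner_smul_right]
  have ht2 : ∀ y ∈ U, IsFocalFrame.traceCLM W (R y ∘L R y) = 2 * (a⁻¹) ^ 2 := fun y hy ↦ by
    obtain ⟨e', he'⟩ := he y hy
    rw [traceCLM_eq_sum e']
    simp [hRe y hy _ _ (he' _), Fin.sum_univ_succ, inner_smul_right]
    ring
  have hsq := hR.trace_fderiv_sq ht2 hXd hX hx
  have h1 := hR.traceCLM_fderiv_eq_zero ht hx (X x)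
  have h2 := hR.traceCLM_comp_fderiv_eq_zero ht2 hx (X x)
  have hPR := hR.fderiv_R_comp_P hx (hX x hx)
  have hRsymm : ∀ y ∈ U, ∀ v w, inner ℝ (R y v) w = inner ℝ v (R y w) := fun y hy v w ↦ by
    obtain ⟨e', he'⟩ := he y hy
    exact inner_diagonal e' (fun i ↦ hRe y hy _ _ (he' i)) v w
  have hR' := hasFDerivAt_of_contDiffOn h.isOpen hR.contDiffOn_R hx
  have hsymm : ∀ v w, inner ℝ (fderiv ℝ R x (X x) v) w = inner ℝ v (fderiv ℝ R x (X x) w) := by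
    intro v w
    have hv := hR'.clm_apply (hasFDerivAt_const v x)
    have hw := hR'.clm_apply (hasFDerivAt_const w x)
    have := eq_of_hasFDerivAt_of_eqOn h.isOpen (fun y hy ↦ hRsymm y hy v w) hx
      (hv.inner ℝ (hasFDerivAt_const w x)) ((hasFDerivAt_const v x).inner ℝ hw)
    have := DFunLike.congr_fun this (X x)
    simpa [fderivInnerCLM_apply] using this
  generalize fderiv ℝ R x (X x) = B at *
  -- `B = B P`, and `P` kills the null vectors, so only the block of `e 4` and `e 5` can survive.
  have hB : ∀ i : Fin 6, (![0, 0, 0, 0, a, -a] : Fin 6 → ℝ) i = 0 → B (e i) = 0 := by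
    intro i hi
    rw [← hPR]
    simp [hRe x hx _ _ (hex i), hi]
  have hB0 := hB 0 rfl
  have hB1 := hB 1 rfl
  have hB2 := hB 2 rfl
  have hB3 := hB 3 rfl
  rw [traceCLM_eq_sum e] at h1 h2 hsq
  have h2' : ∀ i, inner ℝ (e i) ((R x ∘L B) (e i)) =
      ((![0, 0, 0, 0, a, -a] : Fin 6 → ℝ) i)⁻¹ * inner ℝ (e i) (B (e i)) := fun i ↦ by
    rw [ContinuousLinearMap.comp_apply, ← hRsymm x hx, hRe x hx _ _ (hex i), inner_smul_left]
    simp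
  simp only [h2'] at h2
  simp [Fin.sum_univ_six, hB0, hB1, hB2, hB3] at h1 h2 hsq
  -- `tr B = 0` and `tr (R B) = 0` say that the two diagonal entries have zero sum and zero
  -- difference.
  have h44 : inner ℝ (e 4) (B (e 4)) = 0 := by
    have : a⁻¹ ≠ 0 := inv_ne_zero ha
    have h3 : a⁻¹ * (inner ℝ (e 4) (B (e 4)) - inner ℝ (e 5) (B (e 5))) = 0 := by
      rw [mul_sub]; linarith
    have := (mul_eq_zero.1 h3).resolve_left this
    linarith
  have h55 : inner ℝ (e 5) (B (e 5)) = 0 := by linarith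
  have h45 : inner ℝ (e 4) (B (e 5)) = 0 := by rw [← hsymm, real_inner_comm]; exact h54
  have hz : ∀ j : Fin 6, inner ℝ (e 4) (B (e j)) = 0 ∧ inner ℝ (e 5) (B (e j)) = 0 := by
    intro j
    fin_cases j <;> simp [hB0, hB1, hB2, hB3, h44, h55, h45, h54]
  have hB4 : B (e 4) = 0 := by
    rw [← e.sum_repr' (B (e 4))]
    refine Finset.sum_eq_zero fun j _ ↦ ?_
    rw [← hsymm, real_inner_comm, (hz j).1, zero_smul]
  have hB5 : B (e 5) = 0 := by
    rw [← e.sum_repr' (B (e 5))]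
    refine Finset.sum_eq_zero fun j _ ↦ ?_
    rw [← hsymm, real_inner_comm, (hz j).2, zero_smul]
  rw [hX0] at hsq
  simp [hB4, hB5, ha, hξ0] at hsq

/-- A minimal hypersurface of the unit sphere with constant principal curvatures, one of which
vanishes, has only vanishing principal curvatures. -/
theorem principalCurvatures_eq_zero (h : IsLocalHypersurface U F N) (hW : finrank ℝ W = 6)
    {a b d : ℝ} (habd : a + b + d = 0)
    (hm : ∀ x ∈ U, (ambientShape F N x : W →ₗ[ℝ] W).charpoly.roots =
      {0, 0, 0, a, b, d}) (hU : U.Nonempty) : a = 0 ∧ b = 0 ∧ d = 0 := by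
  have hs := h.sum_inv_eq_zero hW hm hU
  by_cases ha : a = 0
  · obtain rfl : d = -b := by linarith
    subst ha
    have := h.eq_zero_of_roots hW hm hU
    simp [this]
  by_cases hb : b = 0
  · obtain rfl : d = -a := by linarith
    subst hb
    refine absurd (h.eq_zero_of_roots hW (a := a) (fun x hx ↦ ?_) hU) ha
    rw [hm x hx, Multiset.insert_eq_cons a, Multiset.insert_eq_cons 0 {-a}, Multiset.cons_swap]
    rfl
  by_cases hd : d = 0
  · obtain rfl : b = -a := by linarith
    subst hd
    refine absurd (h.eq_zero_of_roots hW (a := a) (fun x hx ↦ ?_) hU) ha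
    rw [hm x hx, Multiset.pair_comm (-a) 0, Multiset.insert_eq_cons a,
      Multiset.insert_eq_cons 0 {-a}, Multiset.cons_swap]
    rfl
  exfalso
  -- Clearing denominators turns `hs` into the vanishing of the second elementary symmetric
  -- function.
  field_simp at hs
  have : a ^ 2 + b ^ 2 + d ^ 2 = 0 := by
    have : (a + b + d) ^ 2 = 0 := by rw [habd]; ring
    nlinarith
  have := pow_pos (abs_pos.2 ha) 2
  rw [sq_abs] at this
  nlinarith [sq_nonneg b, sq_nonneg d]

end IsLocalHypersurface

end Rigidity

/-! ### Passage from the manifold to a chart. -/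

section Chart

variable {n : ℕ} {M : Type*} [TopologicalSpace M] [ChartedSpace (EuclideanSpace ℝ (Fin n)) M]
  [IsManifold (𝓡 n) ∞ M]

theorem isManifold_one : IsManifold (𝓡 n) 1 M :=
  IsManifold.of_le (n := ∞) (WithTop.coe_le_coe.2 le_top)

/-- The derivative of a vector-valued map read in a chart. -/
theorem exists_fderiv_comp_extChartAt_symm (p₀ : M) {x : EuclideanSpace ℝ (Fin n)}
    (hx : x ∈ (extChartAt (𝓡 n) p₀).target) :
    ∃ A : EuclideanSpace ℝ (Fin n) ≃L[ℝ] TangentSpace (𝓡 n) ((extChartAt (𝓡 n) p₀).symm x),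
      ∀ g : M → Ambient n,
        MDifferentiableAt (𝓡 n) 𝓘(ℝ, Ambient n) g ((extChartAt (𝓡 n) p₀).symm x) →
        ∀ v, fderiv ℝ (fun y ↦ g ((extChartAt (𝓡 n) p₀).symm y)) x v =
          mvfderiv (𝓡 n) g ((extChartAt (𝓡 n) p₀).symm x) (A v) := by
  have := isManifold_one (n := n) (M := M)
  obtain ⟨A, hA⟩ := isInvertible_mfderivWithin_extChartAt_symm (I := 𝓡 n) (x := p₀) hx
  refine ⟨A, fun g hg v ↦ ?_⟩
  have h1 : MDifferentiableAt 𝓘(ℝ, EuclideanSpace ℝ (Fin n)) (𝓡 n)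
      (extChartAt (𝓡 n) p₀).symm x := by
    have := mdifferentiableWithinAt_extChartAt_symm (I := 𝓡 n) hx
    rwa [ModelWithCorners.range_eq_univ, mdifferentiableWithinAt_univ] at this
  rw [ModelWithCorners.range_eq_univ, mfderivWithin_univ] at hA
  have h2 := mfderiv_comp_apply x hg h1 v
  rw [← hA] at h2
  rw [← mfderiv_eq_fderiv]
  exact h2

/-- The domain of a unit normal field, read in a chart. -/
def chartDomain (p₀ : M) (U : Set M) : Set (EuclideanSpace ℝ (Fin n)) :=
  (extChartAt (𝓡 n) p₀).target ∩ (extChartAt (𝓡 n) p₀).symm ⁻¹' U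

variable {f : M → UnitSphere n} {ν : M → Ambient n} {U : Set M}

theorem IsHypersurface.contMDiff_coe (hf : IsHypersurface f) :
    ContMDiff (𝓡 n) 𝓘(ℝ, Ambient n) ∞ (fun q ↦ (f q : Ambient n)) := by
  have : Fact (finrank ℝ (Ambient n) = n + 1 + 1) := ⟨finrank_euclideanSpace_fin⟩
  exact contMDiff_coe_sphere.comp hf.contMDiff

theorem IsUnitNormalOn.mdifferentiableAt (hν : IsUnitNormalOn f ν U) {p : M} (hp : p ∈ U) :
    MDifferentiableAt (𝓡 n) 𝓘(ℝ, Ambient n) ν p :=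
  (hν.contMDiffOn.contMDiffAt (hν.isOpen.mem_nhds hp)).mdifferentiableAt (by simp)

/-- A hypersurface with unit normal field, read in a chart. -/
theorem IsHypersurface.isLocalHypersurface (hf : IsHypersurface f) (hν : IsUnitNormalOn f ν U)
    (p₀ : M) :
    IsLocalHypersurface (chartDomain p₀ U)
      (fun x ↦ (f ((extChartAt (𝓡 n) p₀).symm x) : Ambient n))
      (fun x ↦ ν ((extChartAt (𝓡 n) p₀).symm x)) where
  isOpen := (continuousOn_extChartAt_symm p₀).isOpen_inter_preimage
    (isOpen_extChartAt_target p₀) hν.isOpen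
  finrank_eq := by simp
  contDiffOn_F := by
    rw [← contMDiffOn_iff_contDiffOn]
    exact hf.contMDiff_coe.comp_contMDiffOn
      ((contMDiffOn_extChartAt_symm p₀).mono Set.inter_subset_left)
  contDiffOn_N := by
    rw [← contMDiffOn_iff_contDiffOn]
    exact hν.contMDiffOn.comp ((contMDiffOn_extChartAt_symm p₀).mono Set.inter_subset_left)
      fun x hx ↦ hx.2
  norm_F := fun x _ ↦ by simp
  norm_N := fun x hx ↦ hν.norm_eq_one _ hx.2
  inner_F_N := fun x hx ↦ by rw [real_inner_comm]; exact hν.tangent_sphere _ hx.2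
  inner_N_fderiv := fun x hx v ↦ by
    obtain ⟨A, hA⟩ := exists_fderiv_comp_extChartAt_symm p₀ hx.1
    rw [hA _ (hf.contMDiff_coe.mdifferentiableAt (by simp))]
    exact hν.normal _ hx.2 _
  injective := fun x hx ↦ by
    obtain ⟨A, hA⟩ := exists_fderiv_comp_extChartAt_symm p₀ hx.1
    intro v w h
    rw [hA _ (hf.contMDiff_coe.mdifferentiableAt (by simp)),
      hA _ (hf.contMDiff_coe.mdifferentiableAt (by simp))] at h
    exact A.injective (hf.injective_differential _ h)

theorem IsHypersurface.charpoly_ambientShape (hf : IsHypersurface f) (hν : IsUnitNormalOn f ν U)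
    (p₀ : M) {x : EuclideanSpace ℝ (Fin n)} (hx : x ∈ chartDomain p₀ U) :
    (ambientShape (fun x ↦ (f ((extChartAt (𝓡 n) p₀).symm x) : Ambient n))
      (fun x ↦ ν ((extChartAt (𝓡 n) p₀).symm x)) x : Ambient n →ₗ[ℝ] Ambient n).charpoly =
    (shapeOperator f ν ((extChartAt (𝓡 n) p₀).symm x)).charpoly * Polynomial.X ^ 2 := by
  have h := hf.isLocalHypersurface hν p₀
  obtain ⟨A, hA⟩ := exists_fderiv_comp_extChartAt_symm p₀ hx.1
  have hFA := hA _ (hf.contMDiff_coe.mdifferentiableAt (by simp))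
  have hNA := hA _ (hν.mdifferentiableAt hx.2)
  obtain ⟨G, hG⟩ := h.isInvertible hx
  refine charpoly_of_adaptedFrame
    ((A.symm.toLinearEquiv.prodCongr (LinearEquiv.refl ℝ (ℝ × ℝ))).trans G.toLinearEquiv) _ _ ?_
  have hG' : ∀ v s t, G (v, s, t) = _ := fun v s t ↦
    (DFunLike.congr_fun hG (v, s, t)).trans (adaptedFrame_apply _ _ _ v s t)
  intro v s t
  change ambientShape _ _ x (G (A.symm v, s, t)) =
    G (A.symm (shapeOperator f ν ((extChartAt (𝓡 n) p₀).symm x) v), 0, 0)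
  rw [hG', hG', map_add, map_add, map_smul, map_smul, h.ambientShape_fderiv hx,
    h.ambientShape_F hx, h.ambientShape_N hx, hFA, hNA, A.apply_symm_apply, A.apply_symm_apply]
  have := differential_shapeOperator hf hν hx.2 v
  simp only [smul_zero, add_zero, zero_smul]
  exact this.symm

theorem IsHypersurface.roots_ambientShape (hf : IsHypersurface f) (hν : IsUnitNormalOn f ν U)
    (p₀ : M) {x : EuclideanSpace ℝ (Fin n)} (hx : x ∈ chartDomain p₀ U) :
    (ambientShape (fun x ↦ (f ((extChartAt (𝓡 n) p₀).symm x) : Ambient n))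
      (fun x ↦ ν ((extChartAt (𝓡 n) p₀).symm x)) x :
        Ambient n →ₗ[ℝ] Ambient n).charpoly.roots =
    0 ::ₘ 0 ::ₘ principalCurvatures f ν ((extChartAt (𝓡 n) p₀).symm x) := by
  rw [hf.charpoly_ambientShape hν p₀ hx, Polynomial.roots_mul
    (mul_ne_zero (LinearMap.charpoly_monic _).ne_zero (by simp)), Polynomial.roots_X_pow,
    add_comm, two_nsmul, add_assoc]
  rfl

theorem mem_chartDomain {p : M} (hp : p ∈ U) :
    extChartAt (𝓡 n) p p ∈ chartDomain p U :=
  ⟨mem_extChartAt_target p, by simpa using hp⟩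

/-- The polynomial divides that of the ambient shape operator, which is self-adjoint; no inner
product on the tangent space is needed. -/
theorem IsHypersurface.splits_charpoly (hf : IsHypersurface f) (hν : IsUnitNormalOn f ν U)
    {p : M} (hp : p ∈ U) : (shapeOperator f ν p).charpoly.Splits := by
  have h := (hf.isLocalHypersurface hν p).isSymmetric_ambientShape (mem_chartDomain hp)
  have h' := h.splits_charpoly
  rw [hf.charpoly_ambientShape hν p (mem_chartDomain hp), extChartAt_to_inv] at h'
  exact h'.of_dvd (mul_ne_zero (LinearMap.charpoly_monic _).ne_zero (by simp))
    (dvd_mul_right _ _)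

/-- If the shape operator with respect to one unit normal field vanishes at a point, then so does
the second fundamental form with respect to every unit normal field. -/
theorem IsHypersurface.secondFundamentalForm_eq_zero (hf : IsHypersurface f)
    (hν : IsUnitNormalOn f ν U) {ν' : M → Ambient n} {U' : Set M} (hν' : IsUnitNormalOn f ν' U')
    {p₀ q : M} {x : EuclideanSpace ℝ (Fin n)} (hq : (extChartAt (𝓡 n) p₀).symm x = q)
    (hx : x ∈ chartDomain p₀ U) (hx' : x ∈ chartDomain p₀ U')
    (h0 : ambientShape (fun x ↦ (f ((extChartAt (𝓡 n) p₀).symm x) : Ambient n))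
      (fun x ↦ ν' ((extChartAt (𝓡 n) p₀).symm x)) x = 0) (v w : TangentSpace (𝓡 n) q) :
    secondFundamentalForm f ν q v w = 0 := by
  subst hq
  have h := hf.isLocalHypersurface hν p₀
  have h' := hf.isLocalHypersurface hν' p₀
  obtain ⟨A, hA⟩ := exists_fderiv_comp_extChartAt_symm p₀ hx.1
  have hFA := hA _ (hf.contMDiff_coe.mdifferentiableAt (by simp))
  have hNA := hA _ (hν.mdifferentiableAt hx.2)
  obtain ⟨v, rfl⟩ := A.surjective v
  obtain ⟨w, rfl⟩ := A.surjective w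
  rw [secondFundamentalForm, differential, ← hFA, ← hNA, h.inner_fderiv_fderiv hx, neg_neg]
  have hν'0 := h'.inner_fderiv_fderiv hx' v w
  have hN0 := h'.ambientShape_fderiv hx' v
  rw [h0] at hN0
  rw [neg_eq_zero.1 hN0.symm, inner_zero_left, zero_eq_neg] at hν'0
  -- Expanding `ν` in the frame of `ν'` and pairing with its own tangent part and with `f` leaves `ν
  -- = t ν'`, so the two second fundamental forms are proportional.
  obtain ⟨u, s, t, hu⟩ := h'.exists_eq hx' (ν ((extChartAt (𝓡 n) p₀).symm x))
  have hu0 := congrArg (fun z ↦ inner ℝ z (fderiv ℝ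
    (fun x ↦ (f ((extChartAt (𝓡 n) p₀).symm x) : Ambient n)) x u)) hu
  have hs0 := congrArg (inner ℝ (f ((extChartAt (𝓡 n) p₀).symm x) : Ambient n)) hu
  simp only [h.inner_N_fderiv x hx, inner_add_left, inner_smul_left, h'.inner_N_fderiv x hx',
    h.inner_F_fderiv hx, mul_zero, add_zero] at hu0
  simp only [h.inner_F_N x hx, inner_add_right, inner_smul_right, h'.inner_F_N x hx',
    h.inner_F_fderiv hx, mul_zero, add_zero, zero_add] at hs0
  rw [inner_self_eq_zero.1 hu0.symm] at hu
  simp at hs0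
  rw [← hs0, zero_smul, zero_add, zero_add] at hu
  rw [hu, inner_smul_left, hν'0, mul_zero]

/-- The principal curvatures of a hypersurface with vanishing mean and Gauss curvatures. -/
theorem IsHypersurface.exists_principalCurvatures_eq {M : Type*} [TopologicalSpace M]
    [ChartedSpace (EuclideanSpace ℝ (Fin 4)) M] [IsManifold (𝓡 4) ∞ M] {f : M → UnitSphere 4}
    {ν : M → Ambient 4} {U : Set M} (hf : IsHypersurface f) (hν : IsUnitNormalOn f ν U) {p : M}
    (hp : p ∈ U) (hH : meanCurvature f ν p = 0) (hK : gaussCurvature f ν p = 0) :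
    ∃ a b d : ℝ, principalCurvatures f ν p = {0, a, b, d} ∧ a + b + d = 0 := by
  have hs := hf.splits_charpoly hν hp
  have hsum : (principalCurvatures f ν p).sum = 0 := by
    have := Module.End.trace_eq_sum_roots_charpoly_of_splits hs
    rw [principalCurvatures, ← this]
    simpa [meanCurvature] using hH
  have h0 : (0 : ℝ) ∈ principalCurvatures f ν p := by
    have := Module.End.det_eq_prod_roots_charpoly_of_splits hs
    rw [← Multiset.prod_eq_zero_iff, principalCurvatures, ← this]
    exact hK
  have hcard : (principalCurvatures f ν p).card = 4 := by
    rw [principalCurvatures, Polynomial.splits_iff_card_roots.1 hs, LinearMap.charpoly_natDegree]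
    exact finrank_euclideanSpace_fin
  obtain ⟨s, hs⟩ := Multiset.exists_cons_of_mem h0
  rw [hs, Multiset.card_cons] at hcard
  obtain ⟨a, b, d, rfl⟩ := Multiset.card_eq_three.1 (Nat.succ.inj hcard)
  refine ⟨a, b, d, hs, ?_⟩
  rw [hs] at hsum
  simpa [add_assoc] using hsum

end Chart

end SphereHypersurface

end

theorem lemma3p2 {M : Type*} [TopologicalSpace M] [ChartedSpace (EuclideanSpace ℝ (Fin 4)) M]
    [IsManifold (𝓡 4) ∞ M] (f : M → Metric.sphere (0 : EuclideanSpace ℝ (Fin 6)) 1)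
    (hf : SphereHypersurface.IsHypersurface f)
    (hmin : SphereHypersurface.IsMinimal f)
    (hiso : SphereHypersurface.IsIsoparametric f)
    (hgauss : SphereHypersurface.HasZeroGaussCurvature f) :
    SphereHypersurface.IsTotallyGeodesic f := by
  intro U ν hν p hp v w
  obtain ⟨c, hc⟩ := hiso
  obtain ⟨U', ν', hp', hν', hcU⟩ := hc p
  obtain ⟨a, b, d, habd, hsum⟩ := hf.exists_principalCurvatures_eq hν' hp' (hmin U' ν' hν' p hp')
    (hgauss U' ν' hν' p hp')
  rw [hcU p hp'] at habd
  have h := hf.isLocalHypersurface hν' p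
  have hW : Module.finrank ℝ (SphereHypersurface.Ambient 4) = 6 := finrank_euclideanSpace_fin
  have hx := SphereHypersurface.mem_chartDomain (n := 4) hp
  have hx' := SphereHypersurface.mem_chartDomain (n := 4) hp'
  have hroots := fun x hx ↦ hf.roots_ambientShape hν' p (x := x) hx
  obtain ⟨rfl, rfl, rfl⟩ := h.principalCurvatures_eq_zero hW hsum
    (fun x hx ↦ by rw [hroots x hx, hcU _ hx.2, habd]; rfl) ⟨_, hx'⟩
  refine hf.secondFundamentalForm_eq_zero hν hν' (extChartAt_to_inv p) hx hx' ?_ v w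
  -- All six ambient eigenvalues are now `0`, so a symmetric operator with this spectrum vanishes on
  -- an eigenbasis.
  obtain ⟨e, he⟩ := h.exists_orthonormalBasis hW (m := 0)
    (fun x hx ↦ by rw [hroots x hx, hcU _ hx.2, habd]; rfl) _ hx'
  apply ContinuousLinearMap.coe_injective
  exact e.toBasis.ext fun i ↦ by simpa using he i
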